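/- For $(\alpha,\beta)\in U=\{(\alpha,\beta): \tfrac12<\beta\le 1,\ 1-\beta<\alpha<\beta\}$ let $T_{\alpha,\beta}$ be the skew tent map $$T_{\alpha,\beta}(x)=\frac{\beta}{\alpha}x\ \ (x\le\alpha),\qquad T_{\alpha,\beta}(x)=\frac{\beta}{1-\alpha}(1-x)\ \ (x>\alpha).$$ The extended itinerary of $x$ is the sequence whose $n$-th entry ($n\ge 0$) is $L$, $C$ or $R$ according as $T^n_{\alpha,\beta}(x)<\alpha$, $=\alpha$ or $>\alpha$; the itinerary $\underline I_{\alpha,\beta}(x)$ is obtained from it by stopping right after the first $C$, if there is one. The kneading sequence is $K(\alpha,\beta)=\underline I_{\alpha,\beta}(\beta)$, and $\mathfrak M=\{K(\tfrac12,\beta):\tfrac12<\beta\le 1\}$. Itineraries are ordered by the parity-lexicographic order $\prec$: put $L\prec C\prec R$; if $\underline A$ and $\underline B$ first differ at the $n$-th entry, then $\underline A\prec\underline B$ iff either $A_0\dots A_{n-1}$ contains an even number of $R$'s and $A_n\prec B_n$, or it contains an odd number of $R$'s and $B_n\prec A_n$. For $\underline M\in\mathfrak M$ let $\underline M^-=\underline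 M$ if $\underline M$ is infinite; if $\underline M=A_0\dots A_{n-1}C$, let $\underline M^-=(A_0\dots A_{n-1}L)^\infty$ or $(A_0\dots A_{n-1}R)^\infty$, according as the number of $R$'s in $A_0\dots A_{n-1}$ is even or odd. **Theorem.** Let $\underline M\in\mathfrak M\setminus\{RL^\infty\}$ and let $(\alpha,\beta)\in U$ with $K(\alpha,\beta)\succ\underline M$. Then $\underline M^-$ has the form $$\underline M^-=R\,L^{m_1}R\,L^{m_2}R\,L^{m_3}\cdots\qquad(m_k\ge 0),$$ and, with $\overline m_k=m_1+\dots+m_k$, the series $$\Theta_{\underline M}(\alpha,\beta)=1-\beta+\sum_{k=1}^\infty(-1)^k\left(\frac{1-\alpha}{\beta}\right)^k\left(\frac{\alpha}{\beta}\right)^{\overline m_k}$$ converges absolutely and $\Theta_{\underline M}(\alpha,\beta)\neq 0$. -/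

import Mathlib

open Filter Topology

noncomputable section

namespace SkewTent

/-- The skew tent map `T_{α,β}` with turning point `(α, β)`. -/
def T (α β x : ℝ) : ℝ :=
  if x ≤ α then β / α * x else β / (1 - α) * (1 - x)

/-- The parameter region `U = {(α, β) : 1/2 < β ≤ 1, 1 - β < α < β}`. -/
def U : Set (ℝ × ℝ) :=
  {p | 1 / 2 < p.2 ∧ p.2 ≤ 1 ∧ 1 - p.2 < p.1 ∧ p.1 < p.2}

/-- The alphabet `{L, C, R}`. -/
inductive Symbol
  | L
  | C
  | R
  deriving DecidableEq

/-- The order `L ≺ C ≺ R` of the alphabet. -/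
def Symbol.Lt : Symbol → Symbol → Prop
  | .L, .C => True
  | .L, .R => True
  | .C, .R => True
  | _, _ => False

/-- Finite or infinite strings of symbols: the `n`-th entry is `none` past the end of the string. -/
abbrev Str := ℕ → Option Symbol

/-- The extended itinerary `I_E(x)` of `x` under `T_{α,β}`, always an infinite sequence. -/
def extItinerary (α β x : ℝ) (n : ℕ) : Symbol :=
  if (T α β)^[n] x < α then .L else if (T α β)^[n] x = α then .C else .R

/-- The itinerary `I(x)`: the extended itinerary, stopped right after its first `C` (if any). -/
def itinerary (α β x : ℝ) : Str := fun n =>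
  if ∃ j < n, extItinerary α β x j = .C then none else some (extItinerary α β x n)

/-- The kneading sequence `K(α, β) = I_{α,β}(β)`. -/
def kneading (α β : ℝ) : Str := itinerary α β β

/-- The number of symbols `R` among the first `n` entries of `A`. -/
def numR (A : Str) (n : ℕ) : ℕ := ((Finset.range n).filter fun i => A i = some .R).card

/-- The symbolic (parity-lexicographic) order `A ≺ B`, decided at the first entry `n` where the
two strings differ: the order of the two entries counts as it is if the common initial string has
an even number of `R`s, and is reversed otherwise. -/
def Prec (A B : Str) : Prop :=
  ∃ (n : ℕ) (a b : Symbol), (∀ i < n, A i = B i) ∧ A n = some a ∧ B n = some b ∧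
    ((Even (numR A n) ∧ a.Lt b) ∨ (¬ Even (numR A n) ∧ b.Lt a))

/-- The class `𝔐` of the kneading sequences `K(1/2, β)`, `1/2 < β ≤ 1`. -/
def kneadingClass : Set Str := {M | ∃ β : ℝ, 1 / 2 < β ∧ β ≤ 1 ∧ M = kneading (1 / 2) β}

/-- The infinite sequence `R L L L …`. -/
def RLinf : Str := fun n => if n = 0 then some .R else some .L

open Classical in
/-- The infinite sequence `M⁻`: it is `M` itself if `M` is infinite; if `M = A₀ … A_{N-1} C`, it
is the periodic sequence `(A₀ … A_{N-1} L)^∞` or `(A₀ … A_{N-1} R)^∞`, according as the number of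
`R`s in `A₀ … A_{N-1}` is even or odd. (The value `C` of `getD` is never used for itineraries.) -/
def minus (M : Str) (n : ℕ) : Symbol :=
  if h : ∃ N, M N = some .C then
    if n % (Nat.find h + 1) < Nat.find h then (M (n % (Nat.find h + 1))).getD .C
    else if Even (numR M (Nat.find h)) then .L else .R
  else (M n).getD .C

/- The next lemmas check that `M⁻`, for `M = K(α, β)`, is the limit of the extended itineraries
`I_E(x)` as `x` tends to `β` from the left. -/

theorem extItinerary_eq_C {α β x : ℝ} {n : ℕ} :
    extItinerary α β x n = .C ↔ (T α β)^[n] x = α := by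
  unfold extItinerary
  split_ifs with h h'
  · simp [h.ne]
  · simp [h']
  · simp [h']

theorem continuous_T {α β : ℝ} (h0 : 0 < α) (h1 : α < 1) : Continuous (T α β) := by
  unfold T
  refine Continuous.if_le (by fun_prop) (by fun_prop) continuous_id continuous_const ?_
  intro x hx
  have : (1 : ℝ) - α ≠ 0 := by linarith
  have hx' : x = α := hx
  subst hx'
  field_simp

theorem T_lt_left {α β x y : ℝ} (h0 : 0 < α) (hβ : 0 < β) (hxy : x < y) (hy : y ≤ α) :
    T α β x < T α β y := by
  rw [T, T, if_pos (hxy.le.trans hy), if_pos hy]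
  exact mul_lt_mul_of_pos_left hxy (by positivity)

theorem T_lt_right {α β x y : ℝ} (h0 : 0 < α) (h1 : α < 1) (hβ : 0 < β) (hxy : x < y)
    (hx : α ≤ x) : T α β y < T α β x := by
  have h1' : 0 < 1 - α := by linarith
  have hc : 0 < β / (1 - α) := by positivity
  have key : T α β x = β / (1 - α) * (1 - x) := by
    rcases hx.eq_or_lt with rfl | h
    · rw [T, if_pos le_rfl]
      field_simp
    · rw [T, if_neg (not_le.2 h)]
  rw [key, T, if_neg (not_le.2 (hx.trans_lt hxy))]
  exact mul_lt_mul_of_pos_left (by linarith) hc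

theorem tendsto_T_of_eventually {α β y : ℝ} (h0 : 0 < α) (h1 : α < 1) {s t : Set ℝ}
    (h : ∀ᶠ x in 𝓝[s] y, T α β x ∈ t) : Tendsto (T α β) (𝓝[s] y) (𝓝[t] (T α β y)) :=
  tendsto_nhdsWithin_iff.2 ⟨((continuous_T h0 h1).tendsto y).mono_left nhdsWithin_le_nhds, h⟩

theorem eventually_extItinerary {α β : ℝ} (h0 : 0 < α) (h1 : α < 1) {y : ℝ} {n : ℕ}
    (hn : extItinerary α β y n ≠ .C) :
    ∀ᶠ x in 𝓝 y, extItinerary α β x n = extItinerary α β y n := by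
  have hc : Tendsto (T α β)^[n] (𝓝 y) (𝓝 ((T α β)^[n] y)) :=
    ((continuous_T h0 h1).iterate n).tendsto y
  rw [Ne, extItinerary_eq_C] at hn
  rcases lt_or_gt_of_ne hn with h | h
  · filter_upwards [hc.eventually_lt_const h] with x hx
    simp [extItinerary, hx, h]
  · filter_upwards [hc.eventually_const_lt h] with x hx
    simp [extItinerary, hx.not_gt, h.not_gt, hx.ne', h.ne']

theorem kneading_eq_some {α β : ℝ} {n : ℕ} (h : ∀ j < n, extItinerary α β β j ≠ .C) :
    kneading α β n = some (extItinerary α β β n) := by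
  unfold kneading itinerary
  rw [if_neg]
  push Not
  exact h

theorem tendsto_iterate_side {α β : ℝ} (h0 : 0 < α) (h1 : α < 1) (hβ : 0 < β) (r : ℕ)
    (h : ∀ j < r, extItinerary α β β j ≠ .C) :
    Tendsto (T α β)^[r] (𝓝[<] β)
      (if Even (numR (kneading α β) r) then 𝓝[<] ((T α β)^[r] β) else 𝓝[>] ((T α β)^[r] β)) := by
  induction r with
  | zero => simpa [numR] using tendsto_id
  | succ r ih =>
    have ih' := ih fun j hj => h j (by omega)
    have hk : kneading α β r = some (extItinerary α β β r) :=
      kneading_eq_some fun j hj => h j (by omega)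
    have hr := h r (by omega)
    have hne : (T α β)^[r] β ≠ α := fun e => hr (extItinerary_eq_C.2 e)
    rw [Function.iterate_succ']
    simp only [Function.comp_apply]
    set y := (T α β)^[r] β with hy
    refine Tendsto.comp ?_ ih'
    have hs : numR (kneading α β) (r + 1) =
        numR (kneading α β) r + if kneading α β r = some .R then 1 else 0 := by
      unfold numR
      rw [Finset.range_add_one, Finset.filter_insert]
      split_ifs <;> simp
    rw [hs, hk]
    rcases lt_or_gt_of_ne hne with hlt | hgt
    · have e : extItinerary α β β r = .L := by simp [extItinerary, ← hy, hlt]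
      simp only [e, Option.some.injEq, reduceCtorEq, if_false, add_zero]
      split_ifs
      · apply tendsto_T_of_eventually h0 h1
        filter_upwards [self_mem_nhdsWithin] with x hx
        exact T_lt_left h0 hβ hx hlt.le
      · apply tendsto_T_of_eventually h0 h1
        filter_upwards [self_mem_nhdsWithin, nhdsWithin_le_nhds (eventually_lt_nhds hlt)]
          with x hx hx'
        exact T_lt_left h0 hβ hx hx'.le
    · have e : extItinerary α β β r = .R := by
        simp [extItinerary, ← hy, hgt.not_gt, hgt.ne']
      simp only [e, if_true, Nat.even_add_one]
      split_ifs with h2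
      · apply tendsto_T_of_eventually h0 h1
        filter_upwards [self_mem_nhdsWithin, nhdsWithin_le_nhds (eventually_gt_nhds hgt)]
          with x hx hx'
        exact T_lt_right h0 h1 hβ hx hx'.le
      · apply tendsto_T_of_eventually h0 h1
        filter_upwards [self_mem_nhdsWithin] with x hx
        exact T_lt_right h0 h1 hβ hx hgt.le

theorem minus_kneading_eq_limit {α β : ℝ} (hU : (α, β) ∈ U) (n : ℕ) :
    ∀ᶠ x in 𝓝[<] β, extItinerary α β x n = minus (kneading α β) n := by
  obtain ⟨hβ1, hβ2, hα1, hα2⟩ := hU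
  simp only at hβ1 hβ2 hα1 hα2
  have h0 : 0 < α := by linarith
  have h1 : α < 1 := by linarith
  have hβ : 0 < β := by linarith
  by_cases hC : ∃ N, extItinerary α β β N = .C
  · classical
    obtain ⟨N, hN, hmin⟩ : ∃ N, extItinerary α β β N = .C ∧
        ∀ j < N, extItinerary α β β j ≠ .C :=
      ⟨Nat.find hC, Nat.find_spec hC, fun j hj => Nat.find_min hC hj⟩
    have hk : ∀ r ≤ N, kneading α β r = some (extItinerary α β β r) := fun r hr =>
      kneading_eq_some fun j hj => hmin j (by omega)
    have hex : ∃ M, kneading α β M = some .C := ⟨N, by rw [hk N le_rfl, hN]⟩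
    have hfind : Nat.find hex = N := by
      rw [Nat.find_eq_iff]
      refine ⟨by rw [hk N le_rfl, hN], fun j hj => ?_⟩
      rw [hk j hj.le]
      simpa using hmin j hj
    have hside := tendsto_iterate_side h0 h1 hβ N hmin
    have hTN : (T α β)^[N] β = α := extItinerary_eq_C.1 hN
    have hTα : T α β α = β := by
      rw [T, if_pos le_rfl]
      field_simp
    rw [hTN] at hside
    have hper : Tendsto (T α β)^[N + 1] (𝓝[<] β) (𝓝[<] β) := by
      rw [Function.iterate_succ']
      refine Tendsto.comp ?_ hside
      have hL : Tendsto (T α β) (𝓝[<] α) (𝓝[<] β) := by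
        have : Tendsto (T α β) (𝓝[<] α) (𝓝[<] (T α β α)) := by
          apply tendsto_T_of_eventually h0 h1
          filter_upwards [self_mem_nhdsWithin] with x hx
          exact T_lt_left h0 hβ hx le_rfl
        rwa [hTα] at this
      have hR : Tendsto (T α β) (𝓝[>] α) (𝓝[<] β) := by
        have : Tendsto (T α β) (𝓝[>] α) (𝓝[<] (T α β α)) := by
          apply tendsto_T_of_eventually h0 h1
          filter_upwards [self_mem_nhdsWithin] with x hx
          exact T_lt_right h0 h1 hβ hx le_rfl
        rwa [hTα] at this
      split_ifs
      · exact hL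
      · exact hR
    have hq : Tendsto ((T α β)^[N + 1])^[n / (N + 1)] (𝓝[<] β) (𝓝[<] β) := hper.iterate _
    have hr : n % (N + 1) ≤ N := Nat.lt_succ_iff.1 (Nat.mod_lt _ (Nat.succ_pos _))
    have hbase : ∀ᶠ x in 𝓝[<] β,
        extItinerary α β x (n % (N + 1)) = minus (kneading α β) n := by
      unfold minus
      rw [dif_pos hex, hfind]
      split_ifs with c1 c2
      · rw [hk _ hr, Option.getD_some]
        exact nhdsWithin_le_nhds (eventually_extItinerary h0 h1 (hmin _ c1))
      · have e : n % (N + 1) = N := by omega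
        rw [if_pos c2] at hside
        filter_upwards [hside.eventually self_mem_nhdsWithin] with x hx
        have hx' : (T α β)^[N] x < α := hx
        simp [extItinerary, e, hx']
      · have e : n % (N + 1) = N := by omega
        rw [if_neg c2] at hside
        filter_upwards [hside.eventually self_mem_nhdsWithin] with x hx
        have hx' : α < (T α β)^[N] x := hx
        simp [extItinerary, e, hx'.not_gt, hx'.ne']
    filter_upwards [hq.eventually hbase] with x hx
    rw [← hx]
    unfold extItinerary
    rw [← Function.iterate_mul, ← Function.iterate_add_apply, Nat.mod_add_div]
  · push Not at hC
    have hk : ∀ r, kneading α β r = some (extItinerary α β β r) := fun r =>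
      kneading_eq_some fun j _ => hC j
    have hex : ¬ ∃ M, kneading α β M = some .C := by
      rintro ⟨M, hM⟩
      rw [hk, Option.some.injEq] at hM
      exact hC M hM
    unfold minus
    rw [dif_neg hex, hk, Option.getD_some]
    exact nhdsWithin_le_nhds (eventually_extItinerary h0 h1 (hC n))

/-- The number `m_k` (`k ≥ 1`) of symbols `L` between the `k`-th and the `(k+1)`-st symbol `R` of
an infinite sequence `w`. (`Nat.nth` counts from `0`.) -/
def blockLength (w : ℕ → Symbol) (k : ℕ) : ℕ :=
  Nat.nth (fun i => w i = .R) k - Nat.nth (fun i => w i = .R) (k - 1) - 1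

/-- The partial sums `m̄_k = m₁ + … + m_k`. -/
def blockSum (m : ℕ → ℕ) (k : ℕ) : ℕ := ∑ j ∈ Finset.Icc 1 k, m j

open Classical in
/-- The infinite sequence `R L^{m₁} R L^{m₂} R L^{m₃} …`, whose symbols `R` stand exactly at the
positions `k + m̄_k`, `k = 0, 1, 2, …` (positions are counted from `0`). -/
def blockWord (m : ℕ → ℕ) (i : ℕ) : Symbol :=
  if ∃ k, i = k + blockSum m k then .R else .L

/-- The term of index `k` (`k ≥ 1`) of the series `Θ_M(α, β)`, where `M⁻ = R L^{m₁} R L^{m₂} …`. -/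
def thetaTerm (M : Str) (α β : ℝ) (k : ℕ) : ℝ :=
  (-1) ^ k * ((1 - α) / β) ^ k * (α / β) ^ blockSum (blockLength (minus M)) k

/-- The auxiliary function `Θ_M`. -/
def Theta (M : Str) (α β : ℝ) : ℝ := 1 - β + ∑' k : ℕ, thetaTerm M α β (k + 1)

end SkewTent

end

/-! Put p = (1-α)/β and q = α/β. The inverse branches y ↦ 1 - py (symbol R) and y ↦ qy (symbol L) of
T_{α,β} contract, because α and 1 - α are less than β on U. Every word in L, R thus codes a point,
given by an absolutely convergent series with one term for each R. For M⁻ this series is 1 + ∑_{k≥1}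
(-1)^k p^k q^{m̄_k} = Θ_M + β (`hasSum_blocks`), so the claim is that M⁻ does not code β.

Each shift of M⁻ is at most M⁻ (`shift_minus_le`) and M⁻ ≺ K(α,β) (`minus_prec`). Following such a
shift up to its first difference with K(α,β) bounds its distance above β by a contracted copy of the
same distance for a later shift; hence no shift codes a point above β (`codedOrbit_le`). If M⁻ codes
β itself, nothing is lost in these estimates: K(α,β) must end in C, at some position n, and M⁻ has
period n + 1 (`periodic_of_codedOrbit_eq`). The orbit defining M then returns to its start after n +
1 steps (`return_of_periodic`), so it is at the turning point at time n, and M cannot precede K(α,β)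
(`codedOrbit_minus_ne`). -/

namespace SkewTent

/-! ### Inverse branches and coded points -/

/-- The inverse branches `y ↦ 1 - p y` (symbol `R`) and `y ↦ q y` (other symbols). -/
noncomputable def invBranch (p q : ℝ) (s : Symbol) (y : ℝ) : ℝ :=
  if s = .R then 1 - p * y else q * y

/-- The slope of an inverse branch. -/
noncomputable def slope (p q : ℝ) (s : Symbol) : ℝ := if s = .R then -p else q

/-- The slope of the composition of the inverse branches along the first `n` symbols of `w`. -/
noncomputable def coef (p q : ℝ) (w : ℕ → Symbol) (n : ℕ) : ℝ :=
  ∏ j ∈ Finset.range n, slope p q (w j)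

/-- The point coded by the word `w`: the limit of the compositions of inverse branches. -/
noncomputable def codedPoint (p q : ℝ) (w : ℕ → Symbol) : ℝ :=
  ∑' i, if w i = .R then coef p q w i else 0

theorem invBranch_sub (p q : ℝ) (s : Symbol) (y z : ℝ) :
    invBranch p q s y - invBranch p q s z = slope p q s * (y - z) := by
  unfold invBranch slope
  split_ifs <;> ring

theorem coef_succ (p q : ℝ) (w : ℕ → Symbol) (n : ℕ) :
    coef p q w (n + 1) = coef p q w n * slope p q (w n) := by
  rw [coef, Finset.prod_range_succ, coef]

theorem coef_succ' (p q : ℝ) (w : ℕ → Symbol) (n : ℕ) :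
    coef p q w (n + 1) = slope p q (w 0) * coef p q (fun i => w (i + 1)) n := by
  rw [coef, Finset.prod_range_succ', coef, mul_comm]

theorem sub_eq_coef_mul {p q : ℝ} {w : ℕ → Symbol} {u v : ℕ → ℝ} (n : ℕ)
    (hu : ∀ i < n, u i = invBranch p q (w i) (u (i + 1)))
    (hv : ∀ i < n, v i = invBranch p q (w i) (v (i + 1))) :
    u 0 - v 0 = coef p q w n * (u n - v n) := by
  induction n with
  | zero => simp [coef]
  | succ n ih =>
    rw [ih (fun i hi => hu i (by omega)) (fun i hi => hv i (by omega)), hu n (by omega),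
      hv n (by omega), invBranch_sub, coef_succ, mul_assoc]

theorem abs_coef_le {p q l : ℝ} (hp : |p| ≤ l) (hq : |q| ≤ l) (w : ℕ → Symbol) (n : ℕ) :
    |coef p q w n| ≤ l ^ n := by
  rw [coef, Finset.abs_prod]
  calc _ ≤ ∏ _j ∈ Finset.range n, l := by
        refine Finset.prod_le_prod (fun _ _ => abs_nonneg _) fun j _ => ?_
        unfold slope
        split_ifs
        · rwa [abs_neg]
        · exact hq
    _ = l ^ n := by simp

/-- Contraction makes a bounded sequence that follows a given word unique: the initial difference is
the n-th one times a slope product of size at most l ^ n. -/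
theorem eq_of_follow {p q l B : ℝ} (hp : |p| ≤ l) (hq : |q| ≤ l) (hl : l < 1)
    {w : ℕ → Symbol} {u v : ℕ → ℝ} (hu : ∀ i, u i = invBranch p q (w i) (u (i + 1)))
    (hv : ∀ i, v i = invBranch p q (w i) (v (i + 1))) (hB : ∀ i, |u i - v i| ≤ B) :
    u 0 = v 0 := by
  have hl0 : 0 ≤ l := (abs_nonneg p).trans hp
  have h : ∀ n : ℕ, |u 0 - v 0| ≤ l ^ n * B := fun n => by
    rw [sub_eq_coef_mul n (fun i _ => hu i) (fun i _ => hv i), abs_mul]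
    exact mul_le_mul (abs_coef_le hp hq w n) (hB n) (abs_nonneg _) (by positivity)
  have ht : Tendsto (fun n : ℕ => l ^ n * B) atTop (𝓝 0) := by
    simpa using (tendsto_pow_atTop_nhds_zero_of_lt_one hl0 hl).mul_const B
  have := ge_of_tendsto' ht h
  exact sub_eq_zero.1 (abs_nonpos_iff.1 this)

theorem abs_term_le {p q l : ℝ} (hp : |p| ≤ l) (hq : |q| ≤ l) (w : ℕ → Symbol) (i : ℕ) :
    ‖if w i = .R then coef p q w i else 0‖ ≤ l ^ i := by
  split_ifs
  · exact abs_coef_le hp hq w i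
  · simpa using pow_nonneg ((abs_nonneg p).trans hp) i

theorem summable_term {p q l : ℝ} (hp : |p| ≤ l) (hq : |q| ≤ l) (hl : l < 1) (w : ℕ → Symbol) :
    Summable fun i => if w i = .R then coef p q w i else 0 :=
  Summable.of_norm_bounded (summable_geometric_of_lt_one ((abs_nonneg p).trans hp) hl)
    (abs_term_le hp hq w)

theorem abs_codedPoint_le {p q l : ℝ} (hp : |p| ≤ l) (hq : |q| ≤ l) (hl : l < 1)
    (w : ℕ → Symbol) : |codedPoint p q w| ≤ (1 - l)⁻¹ :=
  tsum_of_norm_bounded (hasSum_geometric_of_lt_one ((abs_nonneg p).trans hp) hl)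
    (abs_term_le hp hq w)

/-- The term i = 0 supplies the constant 1 of the R-branch, and all later terms share the slope of
the first symbol as a factor. -/
theorem codedPoint_eq {p q l : ℝ} (hp : |p| ≤ l) (hq : |q| ≤ l) (hl : l < 1)
    (w : ℕ → Symbol) :
    codedPoint p q w = invBranch p q (w 0) (codedPoint p q fun i => w (i + 1)) := by
  rw [codedPoint, (summable_term hp hq hl w).tsum_eq_zero_add]
  have h : ∀ i, (if w (i + 1) = .R then coef p q w (i + 1) else 0) =
      slope p q (w 0) * if w (i + 1) = .R then coef p q (fun i => w (i + 1)) i else 0 := by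
    intro i
    rw [coef_succ']
    split_ifs <;> simp
  simp_rw [h]
  rw [tsum_mul_left, ← codedPoint]
  unfold invBranch slope
  split_ifs
  · simp [coef]
    ring
  · simp

/-! ### Parity of R and signs of slopes -/

theorem numR_succ (A : Str) (n : ℕ) :
    numR A (n + 1) = numR A n + if A n = some .R then 1 else 0 := by
  unfold numR
  rw [Finset.range_add_one, Finset.filter_insert]
  split_ifs <;> simp

theorem numR_congr {A B : Str} {n : ℕ} (h : ∀ i < n, A i = B i) : numR A n = numR B n := by
  unfold numR
  congr 1
  refine Finset.filter_congr fun i hi => ?_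
  rw [h i (Finset.mem_range.1 hi)]

/-- An infinite sequence of symbols as a string. -/
def toStr (w : ℕ → Symbol) : Str := fun i => some (w i)

/-- Each R contributes a factor -p < 0. This ties the parity rule of the symbolic order to the order
of the real line. -/
theorem coef_sign {p q : ℝ} (hp : 0 < p) (hq : 0 < q) (w : ℕ → Symbol) (n : ℕ) :
    (Even (numR (toStr w) n) → 0 < coef p q w n) ∧
      (¬ Even (numR (toStr w) n) → coef p q w n < 0) := by
  induction n with
  | zero => simp [numR, coef]
  | succ n ih =>
    rw [numR_succ, coef_succ]
    by_cases h : w n = .R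
    · simp only [toStr, h, slope, if_true, Nat.even_add_one]
      exact ⟨fun h' => mul_pos_of_neg_of_neg (ih.2 h') (by linarith),
        fun h' => mul_neg_of_pos_of_neg (ih.1 (not_not.1 h')) (by linarith)⟩
    · simp only [toStr, h, slope, if_false, Option.some.injEq, add_zero]
      exact ⟨fun h' => mul_pos (ih.1 h') hq, fun h' => mul_neg_of_neg_of_pos (ih.2 h') hq⟩

theorem coef_ne_zero {p q : ℝ} (hp : 0 < p) (hq : 0 < q) (w : ℕ → Symbol) (n : ℕ) :
    coef p q w n ≠ 0 := by
  by_cases h : Even (numR (toStr w) n)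
  · exact ((coef_sign hp hq w n).1 h).ne'
  · exact ((coef_sign hp hq w n).2 h).ne

theorem coef_eq_pow (p q : ℝ) (w : ℕ → Symbol) (n : ℕ) :
    coef p q w n = (-p) ^ Nat.count (fun i => w i = .R) n *
      q ^ (n - Nat.count (fun i => w i = .R) n) := by
  induction n with
  | zero => simp [coef]
  | succ n ih =>
    rw [coef_succ, ih, Nat.count_succ, slope]
    have hc : Nat.count (fun i => w i = .R) n ≤ n := Nat.count_le _
    split_ifs with h
    · rw [Nat.add_sub_add_right, pow_succ]
      ring
    · rw [add_zero, Nat.succ_sub hc, pow_succ, mul_assoc]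

/-! ### Blocks -/

theorem add_blockSum_blockLength {w : ℕ → Symbol} (h0 : w 0 = .R)
    (hinf : {i | w i = .R}.Infinite) (k : ℕ) :
    k + blockSum (blockLength w) k = Nat.nth (fun i => w i = .R) k := by
  induction k with
  | zero =>
    have : Nat.nth (fun i => w i = .R) 0 = 0 := by
      rw [Nat.nth_zero]
      exact Nat.sInf_eq_zero.2 (Or.inl h0)
    simp [blockSum, this]
  | succ k ih =>
    have hlt := Nat.nth_strictMono hinf (Nat.lt_add_one k)
    rw [blockSum, Finset.sum_Icc_succ_top (by omega), ← blockSum, blockLength, Nat.add_sub_cancel]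
    omega

theorem eq_blockWord {w : ℕ → Symbol} (hw : ∀ i, w i = .L ∨ w i = .R) (h0 : w 0 = .R)
    (hinf : {i | w i = .R}.Infinite) : w = blockWord (blockLength w) := by
  funext i
  unfold blockWord
  have hb := add_blockSum_blockLength h0 hinf
  split_ifs with h
  · obtain ⟨k, rfl⟩ := h
    rw [hb]
    exact Nat.nth_mem_of_infinite hinf k
  · refine (hw i).resolve_right fun hR => h ⟨Nat.count (fun i => w i = .R) i, ?_⟩
    rw [hb]
    exact (Nat.nth_count hR).symm

/-- The k-th R, counted from 0, is preceded by k symbols R and m̄_k other symbols. -/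
theorem coef_nth {p q : ℝ} {w : ℕ → Symbol} (h0 : w 0 = .R)
    (hinf : {i | w i = .R}.Infinite) (k : ℕ) :
    coef p q w (Nat.nth (fun i => w i = .R) k) =
      (-1) ^ k * p ^ k * q ^ blockSum (blockLength w) k := by
  have h := add_blockSum_blockLength h0 hinf k
  rw [coef_eq_pow, Nat.count_nth_of_infinite hinf, neg_pow, ← h, Nat.add_sub_cancel_left]

theorem hasSum_blocks {p q l : ℝ} (hp : |p| ≤ l) (hq : |q| ≤ l) (hl : l < 1) {w : ℕ → Symbol}
    (h0 : w 0 = .R) (hinf : {i | w i = .R}.Infinite) :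
    HasSum (fun k => (-1) ^ k * p ^ k * q ^ blockSum (blockLength w) k) (codedPoint p q w) := by
  have hs := (summable_term hp hq hl w).hasSum
  rw [← codedPoint] at hs
  rw [← (Nat.nth_injective hinf).hasSum_iff] at hs
  · convert hs using 1
    funext k
    have hk : w (Nat.nth (fun i => w i = .R) k) = .R := Nat.nth_mem_of_infinite hinf k
    simp only [Function.comp_apply]
    rw [if_pos hk, coef_nth h0 hinf]
  · intro i hi
    rw [if_neg]
    exact fun hR => hi ⟨_, Nat.nth_count hR⟩

/-! ### Orbits of the turning value -/

/-- The constants of the inverse branches of `T_{α,β}` for `(α, β) ∈ U`. -/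
theorem contraction {α β : ℝ} (hU : (α, β) ∈ U) :
    0 < α ∧ α < 1 ∧ 0 < β ∧ 0 < (1 - α) / β ∧ 0 < α / β ∧
      ∃ l < 1, |(1 - α) / β| ≤ l ∧ |α / β| ≤ l := by
  obtain ⟨hβ1, hβ2, hα1, hα2⟩ := hU
  simp only at hβ1 hβ2 hα1 hα2
  have h0 : 0 < α := by linarith
  have h1 : 0 < 1 - α := by linarith
  have hβ : 0 < β := by linarith
  have hp : 0 < (1 - α) / β := by positivity
  have hq : 0 < α / β := by positivity
  refine ⟨h0, by linarith, hβ, hp, hq, max ((1 - α) / β) (α / β), ?_, ?_, ?_⟩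
  · refine max_lt ?_ ?_ <;> rw [div_lt_one hβ] <;> linarith
  · rw [abs_of_pos hp]
    exact le_max_left _ _
  · rw [abs_of_pos hq]
    exact le_max_right _ _

theorem T_left {α β x : ℝ} (h0 : 0 < α) (hβ : 0 < β) (hx : x ≤ α) :
    x = α / β * T α β x := by
  rw [T, if_pos hx]
  field_simp

theorem T_right {α β x : ℝ} (h0 : 0 < α) (h1 : α < 1) (hβ : 0 < β) (hx : α ≤ x) :
    x = 1 - (1 - α) / β * T α β x := by
  have : 1 - α ≠ 0 := by linarith
  rcases hx.eq_or_lt with rfl | h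
  · rw [T, if_pos le_rfl]
    field_simp
    ring
  · rw [T, if_neg (not_le.2 h)]
    field_simp
    ring

/-- The maximum β is attained only at the turning point, so a return to β must pass through α one
step earlier. -/
theorem eq_of_T_eq {α β x : ℝ} (h0 : 0 < α) (h1 : α < 1) (hβ : 0 < β) (h : T α β x = β) :
    x = α := by
  rcases le_total x α with hx | hx
  · rw [T_left h0 hβ hx, h]
    field_simp
  · rw [T_right h0 h1 hβ hx, h]
    field_simp
    ring

theorem T_turning {α β : ℝ} (h0 : 0 < α) : T α β α = β := by
  rw [T, if_pos le_rfl]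
  field_simp

theorem T_mem_Icc {α β x : ℝ} (h0 : 0 < α) (h1 : α < 1) (hβ : 0 < β) (hβ1 : β ≤ 1)
    (hx : x ∈ Set.Icc 0 β) : T α β x ∈ Set.Icc 0 β := by
  have h1' : 0 < 1 - α := by linarith
  obtain ⟨hx0, hxβ⟩ := hx
  unfold T
  split_ifs with h
  · refine ⟨by positivity, ?_⟩
    rw [div_mul_eq_mul_div, div_le_iff₀ h0]
    exact mul_le_mul_of_nonneg_left h hβ.le
  · refine ⟨mul_nonneg (by positivity) (by linarith), ?_⟩
    rw [div_mul_eq_mul_div, div_le_iff₀ h1']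
    exact mul_le_mul_of_nonneg_left (by linarith) hβ.le

theorem iterate_mem_Icc {α β : ℝ} (hU : (α, β) ∈ U) (n : ℕ) :
    (T α β)^[n] β ∈ Set.Icc 0 β := by
  obtain ⟨h0, h1, hβ, -⟩ := contraction hU
  induction n with
  | zero => simp [hβ.le]
  | succ n ih =>
    rw [Function.iterate_succ_apply']
    exact T_mem_Icc h0 h1 hβ hU.2.1 ih

/-- The point `x` lies (weakly) on the side of `α` named by the symbol `s`. -/
def OnSide (α : ℝ) (s : Symbol) (x : ℝ) : Prop :=
  (s = .L ∧ x ≤ α) ∨ (s = .R ∧ α ≤ x)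

theorem OnSide.eq_invBranch {α β x : ℝ} (hU : (α, β) ∈ U) {s : Symbol} (h : OnSide α s x) :
    x = invBranch ((1 - α) / β) (α / β) s (T α β x) := by
  obtain ⟨h0, h1, hβ, -⟩ := contraction hU
  rcases h with ⟨rfl, h⟩ | ⟨rfl, h⟩
  · simpa [invBranch] using T_left h0 hβ h
  · simpa [invBranch] using T_right h0 h1 hβ h

theorem onSide_extItinerary {α β x : ℝ} {n : ℕ} (h : extItinerary α β x n ≠ .C) :
    OnSide α (extItinerary α β x n) ((T α β)^[n] x) := by
  unfold extItinerary at *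
  split_ifs with h1 h2
  · exact Or.inl ⟨rfl, h1.le⟩
  · simp [h2] at h
  · exact Or.inr ⟨rfl, not_lt.1 h1⟩

theorem kneading_eq_some_iff {α β : ℝ} {n : ℕ} {s : Symbol} :
    kneading α β n = some s ↔
      (∀ j < n, extItinerary α β β j ≠ .C) ∧ extItinerary α β β n = s := by
  constructor
  · intro h
    have h' : ∀ j < n, extItinerary α β β j ≠ .C := by
      by_contra hc
      push Not at hc
      rw [kneading, itinerary, if_pos hc] at h
      cases h
    exact ⟨h', by simpa [kneading_eq_some h'] using h⟩
  · rintro ⟨h, rfl⟩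
    exact kneading_eq_some h

theorem iterate_eq_mod {α β : ℝ} (h0 : 0 < α) {N : ℕ} (hN : (T α β)^[N] β = α) (n : ℕ) :
    (T α β)^[n] β = (T α β)^[n % (N + 1)] β := by
  have h : (T α β)^[N + 1] β = β := by
    rw [Function.iterate_succ_apply', hN, T_turning h0]
  have hp : Function.IsPeriodicPt (T α β) (N + 1) β := h
  exact (hp.iterate_mod_apply n).symm

/-! ### M⁻ along the orbit of β -/

theorem minus_kneading_cases (α β : ℝ) :
    ((∀ j, extItinerary α β β j ≠ .C) ∧ ∀ n, minus (kneading α β) n = extItinerary α β β n) ∨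
    ∃ N, (∀ j < N, extItinerary α β β j ≠ .C) ∧ (T α β)^[N] β = α ∧
      ∀ n, minus (kneading α β) n =
        if n % (N + 1) < N then extItinerary α β β (n % (N + 1))
        else if Even (numR (kneading α β) N) then .L else .R := by
  by_cases hex : ∃ N, kneading α β N = some .C
  · right
    classical
    have hs := kneading_eq_some_iff.1 (Nat.find_spec hex)
    refine ⟨Nat.find hex, hs.1, extItinerary_eq_C.1 hs.2, fun n => ?_⟩
    unfold minus
    rw [dif_pos hex]
    split_ifs with c
    · rw [kneading_eq_some fun j hj => hs.1 j (by omega), Option.getD_some]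
    all_goals rfl
  · left
    have hne : ∀ j, extItinerary α β β j ≠ .C := by
      intro j
      induction j using Nat.strong_induction_on with
      | _ j ih => exact fun hj => hex ⟨j, kneading_eq_some_iff.2 ⟨ih, hj⟩⟩
    refine ⟨hne, fun n => ?_⟩
    unfold minus
    rw [dif_neg hex, kneading_eq_some fun j _ => hne j, Option.getD_some]

/-- Where M⁻ replaces C by L or R the orbit is at α, which lies weakly on both sides. Hence the
orbit of β follows M⁻ through the inverse branches. -/
theorem onSide_minus {α β : ℝ} (hU : (α, β) ∈ U) (n : ℕ) :
    OnSide α (minus (kneading α β) n) ((T α β)^[n] β) := by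
  have h0 := (contraction hU).1
  rcases minus_kneading_cases α β with ⟨h, hm⟩ | ⟨N, h, hN, hm⟩
  · rw [hm]
    exact onSide_extItinerary (h n)
  · rw [hm, iterate_eq_mod h0 hN]
    split_ifs with c1 c2
    · exact onSide_extItinerary (h _ c1)
    all_goals
      have e : n % (N + 1) = N := by
        have := Nat.mod_lt n N.add_one_pos
        omega
      rw [e, hN]
    · exact Or.inl ⟨rfl, le_rfl⟩
    · exact Or.inr ⟨rfl, le_rfl⟩

theorem minus_of_kneading_eq_some {α β : ℝ} {n : ℕ} {s : Symbol}
    (h : kneading α β n = some s) :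
    (s ≠ .C → minus (kneading α β) n = s) ∧
      (s = .C → minus (kneading α β) n = if Even (numR (kneading α β) n) then .L else .R) := by
  obtain ⟨hlt, hn⟩ := kneading_eq_some_iff.1 h
  rcases minus_kneading_cases α β with ⟨h, hm⟩ | ⟨N, h, hN, hm⟩
  · rw [hm, hn]
    exact ⟨fun _ => rfl, fun hs => absurd (hn.trans hs) (h n)⟩
  · have hnN : n ≤ N := by
      by_contra hc
      exact hlt N (by omega) (extItinerary_eq_C.2 hN)
    rw [hm, Nat.mod_eq_of_lt (by omega)]
    rcases hnN.eq_or_lt with rfl | hl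
    · have : s = .C := hn.symm.trans (extItinerary_eq_C.2 hN)
      simp [this]
    · rw [if_pos hl, hn]
      exact ⟨fun _ => rfl, fun hs => absurd (hn.trans hs) (h n hl)⟩

theorem iterate_add_succ {α β x : ℝ} (k i : ℕ) :
    (T α β)^[k + (i + 1)] x = T α β ((T α β)^[k + i] x) := by
  rw [← add_assoc, Function.iterate_succ_apply']

/-- If the orbit of `β` returns to `β` at time `k`, then `M⁻` is invariant under the shift
by `k`. -/
theorem minus_add_of_return {α β : ℝ} (hU : (α, β) ∈ U) {k : ℕ} (hk : (T α β)^[k] β = β)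
    (n : ℕ) : minus (kneading α β) (k + n) = minus (kneading α β) n := by
  obtain ⟨h0, h1, hβ, -⟩ := contraction hU
  rcases minus_kneading_cases α β with ⟨h, hm⟩ | ⟨N, h, hN, hm⟩
  · have : (T α β)^[k + n] β = (T α β)^[n] β := by
      rw [add_comm, Function.iterate_add_apply, hk]
    rw [hm, hm, extItinerary, this, ← extItinerary]
  · have hr : k % (N + 1) = 0 := by
      by_contra hne
      obtain ⟨r, hr⟩ := Nat.exists_eq_succ_of_ne_zero hne
      rw [iterate_eq_mod h0 hN, hr, Function.iterate_succ_apply'] at hk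
      have hlt := Nat.mod_lt k N.add_one_pos
      exact h r (by omega) (extItinerary_eq_C.2 (eq_of_T_eq h0 h1 hβ hk))
    have : (k + n) % (N + 1) = n % (N + 1) := by
      rw [Nat.add_mod, hr, zero_add, Nat.mod_mod]
    rw [hm, hm, this]

/-- `M⁻` is maximal among its shifts. -/
theorem shift_minus_le {α β : ℝ} (hU : (α, β) ∈ U) (k : ℕ) :
    (∀ i, minus (kneading α β) (k + i) = minus (kneading α β) i) ∨
      Prec (toStr fun i => minus (kneading α β) (k + i)) (toStr (minus (kneading α β))) := by
  classical
  set W := minus (kneading α β) with hW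
  obtain ⟨h0, h1, hβ, hp, hq, -⟩ := contraction hU
  by_cases hall : ∀ i, W (k + i) = W i
  · exact Or.inl hall
  right
  push Not at hall
  obtain ⟨j, hj, hmin⟩ : ∃ j, W (k + j) ≠ W j ∧ ∀ i < j, W (k + i) = W i :=
    ⟨Nat.find hall, Nat.find_spec hall, fun i hi => not_not.1 (Nat.find_min hall hi)⟩
  have hside := onSide_minus hU
  rw [← hW] at hside
  -- Up to the first difference j both orbits use the same branches, so T^k β - β is the slope
  -- product times T^{k+j} β - T^j β.
  have hd := sub_eq_coef_mul (p := (1 - α) / β) (q := α / β) (w := fun i => W (k + i))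
    (u := fun i => (T α β)^[k + i] β) (v := fun i => (T α β)^[i] β) j
    (fun i _ => by
      have := (hside (k + i)).eq_invBranch hU
      rwa [← iterate_add_succ] at this)
    (fun i hi => by
      have := (hside i).eq_invBranch hU
      rwa [← hmin i hi, ← Function.iterate_succ_apply' (T α β)] at this)
  simp only [add_zero, Function.iterate_zero, id] at hd
  have hle := (iterate_mem_Icc hU k).2
  -- Equality would give T^k β = β, making M⁻ invariant under the shift by k.
  have hne : (T α β)^[k + j] β ≠ (T α β)^[j] β := by
    intro he
    rw [he, sub_self, mul_zero, sub_eq_zero] at hd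
    exact hj (minus_add_of_return hU hd j)
  have hsgn := coef_sign hp hq (fun i => W (k + i)) j
  refine ⟨j, W (k + j), W j, fun i hi => by simp [toStr, hmin i hi], rfl, rfl, ?_⟩
  -- As T^k β ≤ β, the sign of the slope product orders the two points at time j; lying strictly in
  -- that order, on the sides named by different symbols, they determine these symbols.
  by_cases he : Even (numR (toStr fun i => W (k + i)) j)
  · refine Or.inl ⟨he, ?_⟩
    have hc := hsgn.1 he
    have hlt : (T α β)^[k + j] β < (T α β)^[j] β := by
      refine lt_of_le_of_ne ?_ hne
      by_contra hgt
      have := mul_pos hc (sub_pos.2 (not_le.1 hgt))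
      linarith
    rcases hside (k + j) with ⟨e1, s1⟩ | ⟨e1, s1⟩ <;> rcases hside j with ⟨e2, s2⟩ | ⟨e2, s2⟩
    · exact absurd (e1.trans e2.symm) hj
    · simp [e1, e2, Symbol.Lt]
    · linarith
    · exact absurd (e1.trans e2.symm) hj
  · refine Or.inr ⟨he, ?_⟩
    have hc := hsgn.2 he
    have hlt : (T α β)^[j] β < (T α β)^[k + j] β := by
      refine lt_of_le_of_ne ?_ hne.symm
      by_contra hgt
      have := mul_pos_of_neg_of_neg hc (sub_neg.2 (not_le.1 hgt))
      linarith
    rcases hside (k + j) with ⟨e1, s1⟩ | ⟨e1, s1⟩ <;> rcases hside j with ⟨e2, s2⟩ | ⟨e2, s2⟩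
    · exact absurd (e1.trans e2.symm) hj
    · linarith
    · simp [e1, e2, Symbol.Lt]
    · exact absurd (e1.trans e2.symm) hj

/-! ### Transitivity, and M⁻ against K -/

theorem Symbol.Lt.trans {a b c : Symbol} (h : a.Lt b) (h' : b.Lt c) : a.Lt c := by
  cases a <;> cases b <;> cases c <;> simp_all [Symbol.Lt]

theorem Prec.trans {A B D : Str} (h : Prec A B) (h' : Prec B D) : Prec A D := by
  obtain ⟨n, a, b, he, ha, hb, ho⟩ := h
  obtain ⟨m, b', d, he', hb', hd, ho'⟩ := h'
  rcases lt_trichotomy n m with hnm | rfl | hnm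
  · exact ⟨n, a, b, fun i hi => (he i hi).trans (he' i (hi.trans hnm)), ha,
      (he' n hnm).symm.trans hb, ho⟩
  · obtain rfl : b = b' := Option.some.inj (hb.symm.trans hb')
    rw [← numR_congr he] at ho'
    refine ⟨n, a, d, fun i hi => (he i hi).trans (he' i hi), ha, hd, ?_⟩
    rcases ho with ⟨e, l⟩ | ⟨e, l⟩ <;> rcases ho' with ⟨e', l'⟩ | ⟨e', l'⟩
    · exact Or.inl ⟨e, l.trans l'⟩
    · exact absurd e e'
    · exact absurd e' e
    · exact Or.inr ⟨e, l'.trans l⟩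
  · rw [← numR_congr fun i hi => he i (hi.trans hnm)] at ho'
    exact ⟨m, b', d, fun i hi => (he i (hi.trans hnm)).trans (he' i hi),
      (he m hnm).trans hb', hd, ho'⟩

theorem toStr_minus_eq {α β : ℝ} {n : ℕ} (hn : kneading α β n ≠ none) {i : ℕ} (hi : i < n) :
    toStr (minus (kneading α β)) i = kneading α β i := by
  obtain ⟨s, hs⟩ := Option.ne_none_iff_exists'.1 hn
  have h := (kneading_eq_some_iff.1 hs).1
  have hk := kneading_eq_some fun j (hj : j < i) => h j (hj.trans hi)
  rw [hk, toStr, (minus_of_kneading_eq_some hk).1 (h i hi)]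

/-- Only a C at the first difference is altered. The parity rule in M⁻ replaces it by L after an
even number of R's and by R after an odd number, which lowers the sequence in either case. -/
theorem minus_prec {α β : ℝ} {K : Str} (h : Prec (kneading α β) K) :
    Prec (toStr (minus (kneading α β))) K := by
  obtain ⟨n, a, b, he, ha, hb, ho⟩ := h
  have hn : kneading α β n ≠ none := by simp [ha]
  have heq : ∀ i < n, toStr (minus (kneading α β)) i = kneading α β i :=
    fun i hi => toStr_minus_eq hn hi
  refine ⟨n, minus (kneading α β) n, b, fun i hi => (heq i hi).trans (he i hi), rfl, hb, ?_⟩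
  rw [numR_congr heq]
  obtain ⟨h1, h2⟩ := minus_of_kneading_eq_some ha
  by_cases hC : a = .C
  · rw [h2 hC]
    subst hC
    rcases ho with ⟨e, l⟩ | ⟨e, l⟩
    · rw [if_pos e]
      exact Or.inl ⟨e, Symbol.Lt.trans (b := .C) trivial l⟩
    · rw [if_neg e]
      exact Or.inr ⟨e, Symbol.Lt.trans (b := .C) l trivial⟩
  · rw [h1 hC]
    exact ho

/-! ### Words all of whose shifts precede the kneading sequence -/

/-- The point coded by the `k`-th shift of `w`, for the inverse branches of `T_{α,β}`. -/
noncomputable def codedOrbit (α β : ℝ) (w : ℕ → Symbol) (k : ℕ) : ℝ :=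
  codedPoint ((1 - α) / β) (α / β) fun i => w (k + i)

theorem codedOrbit_eq {α β : ℝ} (hU : (α, β) ∈ U) (w : ℕ → Symbol) (k : ℕ) :
    codedOrbit α β w k = invBranch ((1 - α) / β) (α / β) (w k) (codedOrbit α β w (k + 1)) := by
  obtain ⟨-, -, -, -, -, l, hl, hpl, hql⟩ := contraction hU
  rw [codedOrbit, codedPoint_eq hpl hql hl, codedOrbit]
  simp only [add_zero, add_assoc, add_comm 1]

theorem kneading_eq_invBranch {α β : ℝ} (hU : (α, β) ∈ U) {i : ℕ} {s : Symbol}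
    (h : kneading α β i = some s) :
    (T α β)^[i] β = invBranch ((1 - α) / β) (α / β) s ((T α β)^[i + 1] β) := by
  obtain ⟨h0, h1, hβ, -⟩ := contraction hU
  rw [Function.iterate_succ_apply']
  obtain ⟨-, rfl⟩ := kneading_eq_some_iff.1 h
  by_cases hC : extItinerary α β β i = .C
  · rw [hC]
    simpa [invBranch] using T_left h0 hβ (extItinerary_eq_C.1 hC).le
  · exact (onSide_extItinerary hC).eq_invBranch hU

/-- The comparison at the first difference `n` with the kneading sequence: `codedOrbit α β w k - β`
is a positive multiple of the same difference at `k + n + 1`, minus a nonnegative defect `δ`, which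
vanishes only if `T^n β = α`. -/
theorem codedOrbit_compare {α β : ℝ} (hU : (α, β) ∈ U) {w : ℕ → Symbol}
    (hw : ∀ i, w i = .L ∨ w i = .R) {k : ℕ}
    (h : Prec (toStr fun i => w (k + i)) (kneading α β)) :
    ∃ n b, (∀ i < n, kneading α β i = some (w (k + i))) ∧ kneading α β n = some b ∧
      0 < coef ((1 - α) / β) (α / β) (fun i => w (k + i)) (n + 1) ∧
      (w (k + n) = if Even (numR (kneading α β) n) then .L else .R) ∧
      ∃ δ ≥ 0, (δ = 0 → b = .C) ∧ codedOrbit α β w k - β =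
        coef ((1 - α) / β) (α / β) (fun i => w (k + i)) (n + 1) *
          (codedOrbit α β w (k + (n + 1)) - β) - δ := by
  obtain ⟨h0, h1, hβ, hp, hq, -⟩ := contraction hU
  obtain ⟨n, a, b, he, ha, hb, ho⟩ := h
  obtain rfl : w (k + n) = a := Option.some.inj ha
  set c := coef ((1 - α) / β) (α / β) (fun i => w (k + i)) with hc
  have hd := sub_eq_coef_mul (p := (1 - α) / β) (q := α / β) (w := fun i => w (k + i))
    (u := fun i => codedOrbit α β w (k + i)) (v := fun i => (T α β)^[i] β) n
    (fun i _ => codedOrbit_eq hU w (k + i))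
    (fun i hi => kneading_eq_invBranch hU (he i hi).symm)
  simp only [add_zero, Function.iterate_zero, id] at hd
  -- Both inverse branches send β to α, so a single formula covers whichever symbol w has at the
  -- first difference.
  have hα : ∀ s, α = invBranch ((1 - α) / β) (α / β) s β := by
    intro s
    unfold invBranch
    split_ifs <;> field_simp
    ring
  have hstep : codedOrbit α β w (k + n) - α = slope ((1 - α) / β) (α / β) (w (k + n)) *
      (codedOrbit α β w (k + (n + 1)) - β) := by
    rw [← invBranch_sub, ← hα, codedOrbit_eq hU, add_assoc]
  have hs : c (n + 1) = c n * slope ((1 - α) / β) (α / β) (w (k + n)) := coef_succ _ _ _ _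
  have hsgn := coef_sign hp hq (fun i => w (k + i)) n
  rw [← hc] at hsgn hd
  have hext := (kneading_eq_some_iff.1 hb).2
  have hbC : (T α β)^[n] β = α → b = .C := fun e => hext ▸ extItinerary_eq_C.2 e
  -- The defect arises by splitting u - T^n β as (u - α) - (T^n β - α), where u is the coded point
  -- at time n: the first part becomes the next difference from β, and the second, times the slope
  -- product, is δ.
  refine ⟨n, b, fun i hi => (he i hi).symm, hb, ?_, ?_, c n * ((T α β)^[n] β - α), ?_, ?_, ?_⟩
  · rw [hs]
    rcases ho with ⟨e, l⟩ | ⟨e, l⟩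
    · have hL : w (k + n) = .L := by
        rcases hw (k + n) with h | h
        · exact h
        · rw [h] at l; cases b <;> simp [Symbol.Lt] at l
      rw [hL]
      exact mul_pos (hsgn.1 e) (by simpa [slope] using hq)
    · have hR : w (k + n) = .R := by
        rcases hw (k + n) with h | h
        · cases b <;> simp [h, Symbol.Lt] at l
        · exact h
      rw [hR]
      exact mul_pos_of_neg_of_neg (hsgn.2 e) (by simpa [slope] using hp)
  · rw [← numR_congr he]
    rcases ho with ⟨e, l⟩ | ⟨e, l⟩
    · rw [if_pos e]
      refine (hw (k + n)).resolve_right fun h => ?_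
      rw [h] at l; cases b <;> simp [Symbol.Lt] at l
    · rw [if_neg e]
      refine (hw (k + n)).resolve_left fun h => ?_
      rw [h] at l; cases b <;> simp [Symbol.Lt] at l
  · rcases ho with ⟨e, l⟩ | ⟨e, l⟩
    · refine mul_nonneg (hsgn.1 e).le (sub_nonneg.2 ?_)
      by_contra hlt
      have : b = .L := by rw [← hext, extItinerary, if_pos (not_le.1 hlt)]
      rw [this] at l
      rcases hw (k + n) with h | h <;> simp [h, Symbol.Lt] at l
    · refine mul_nonneg_of_nonpos_of_nonpos (hsgn.2 e).le (sub_nonpos.2 ?_)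
      by_contra hlt
      have hlt := not_le.1 hlt
      have : b = .R := by rw [← hext, extItinerary, if_neg hlt.not_gt, if_neg hlt.ne']
      rw [this] at l
      simp [Symbol.Lt] at l
  · intro hz
    exact hbC (sub_eq_zero.1 ((mul_eq_zero.1 hz).resolve_left (coef_ne_zero hp hq _ _)))
  · rw [hd, hs, mul_assoc, ← hstep]
    ring

/-- A supremum X > β of the coded orbit would satisfy X - β ≤ l (X - β) with l < 1, by
`codedOrbit_compare` after discarding the defect. -/
theorem codedOrbit_le {α β : ℝ} (hU : (α, β) ∈ U) {w : ℕ → Symbol}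
    (hw : ∀ i, w i = .L ∨ w i = .R)
    (h : ∀ k, Prec (toStr fun i => w (k + i)) (kneading α β)) (k : ℕ) :
    codedOrbit α β w k ≤ β := by
  obtain ⟨-, -, -, -, -, l, hl, hpl, hql⟩ := contraction hU
  have hl0 : 0 ≤ l := (abs_nonneg _).trans hpl
  have hbdd : BddAbove (Set.range (codedOrbit α β w)) := by
    refine ⟨(1 - l)⁻¹, ?_⟩
    rintro _ ⟨k, rfl⟩
    exact (le_abs_self _).trans (abs_codedPoint_le hpl hql hl _)
  set X := ⨆ k, codedOrbit α β w k with hX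
  have hle : ∀ k, codedOrbit α β w k ≤ X := le_ciSup hbdd
  by_contra hk
  have hXβ : 0 < X - β := sub_pos.2 ((not_le.1 hk).trans_le (hle k))
  have hkey : ∀ k, codedOrbit α β w k ≤ β + l * (X - β) := by
    intro k
    obtain ⟨n, b, -, -, hc, -, δ, hδ, -, he⟩ := codedOrbit_compare hU hw (h k)
    set c := coef ((1 - α) / β) (α / β) (fun i => w (k + i)) (n + 1)
    have hcl : c ≤ l := by
      refine (le_abs_self c).trans ((abs_coef_le hpl hql _ _).trans ?_)
      rw [pow_succ]
      exact mul_le_of_le_one_left hl0 (pow_le_one₀ hl0 hl.le)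
    have h1 : c * (codedOrbit α β w (k + (n + 1)) - β) ≤ c * (X - β) :=
      mul_le_mul_of_nonneg_left (by linarith [hle (k + (n + 1))]) hc.le
    have h2 : c * (X - β) ≤ l * (X - β) := mul_le_mul_of_nonneg_right hcl hXβ.le
    linarith
  have : X ≤ β + l * (X - β) := ciSup_le hkey
  nlinarith

/-- If the coded orbit starts at `β`, then the kneading sequence is finite and `w` is periodic. -/
theorem periodic_of_codedOrbit_eq {α β : ℝ} (hU : (α, β) ∈ U) {w : ℕ → Symbol}
    (hw : ∀ i, w i = .L ∨ w i = .R)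
    (h : ∀ k, Prec (toStr fun i => w (k + i)) (kneading α β)) (h0 : codedOrbit α β w 0 = β) :
    ∃ n, kneading α β n = some .C ∧ (∀ i < n, kneading α β i = some (w i)) ∧
      ∀ i, w (i + (n + 1)) = w i := by
  -- Starting from β, the comparison reads 0 = c (x - β) - δ with c > 0, x ≤ β and δ ≥ 0. Hence x =
  -- β and δ = 0, and the latter puts a C at the first difference.
  have hret : ∀ k, codedOrbit α β w k = β → ∃ n, (∀ i < n, kneading α β i = some (w (k + i))) ∧
      kneading α β n = some .C ∧
      (w (k + n) = if Even (numR (kneading α β) n) then .L else .R) ∧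
      codedOrbit α β w (k + (n + 1)) = β := by
    intro k hk
    obtain ⟨n, b, hi, hb, hc, hn, δ, hδ, hδ0, he⟩ := codedOrbit_compare hU hw (h k)
    set c := coef ((1 - α) / β) (α / β) (fun i => w (k + i)) (n + 1)
    have hle : codedOrbit α β w (k + (n + 1)) - β ≤ 0 := sub_nonpos.2 (codedOrbit_le hU hw h _)
    have h1 : c * (codedOrbit α β w (k + (n + 1)) - β) ≤ 0 :=
      mul_nonpos_of_nonneg_of_nonpos hc.le hle
    rw [hk, sub_self] at he
    have h2 : c * (codedOrbit α β w (k + (n + 1)) - β) = 0 := by linarith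
    refine ⟨n, hi, ?_, hn, ?_⟩
    · rw [hb, hδ0 (by linarith)]
    · exact sub_eq_zero.1 ((mul_eq_zero.1 h2).resolve_left hc.ne')
  obtain ⟨n, hi, hC, hn, -⟩ := hret 0 h0
  simp only [zero_add] at hi hn
  -- An itinerary has at most one C, so every return takes n + 1 steps and reads the same block.
  have huniq : ∀ m, kneading α β m = some .C → m = n := by
    intro m hm
    have h1 := kneading_eq_some_iff.1 hm
    have h2 := kneading_eq_some_iff.1 hC
    rcases lt_trichotomy m n with hlt | he | hlt
    · exact absurd h1.2 (h2.1 m hlt)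
    · exact he
    · exact absurd h2.2 (h1.1 n hlt)
  have hstep : ∀ k, codedOrbit α β w k = β →
      (∀ i ≤ n, w (k + i) = w i) ∧ codedOrbit α β w (k + (n + 1)) = β := by
    intro k hk
    obtain ⟨m, hi', hC', hn', hr⟩ := hret k hk
    obtain rfl := huniq m hC'
    refine ⟨fun i him => ?_, hr⟩
    rcases him.eq_or_lt with rfl | hlt
    · rw [hn, hn']
    · exact Option.some.inj ((hi' i hlt).symm.trans (hi i hlt))
  have hβ : ∀ j, codedOrbit α β w ((n + 1) * j) = β := by
    intro j
    induction j with
    | zero => simpa using h0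
    | succ j ih => exact (hstep _ ih).2
  refine ⟨n, hC, hi, fun i => ?_⟩
  have hr : i % (n + 1) ≤ n := Nat.lt_succ_iff.1 (Nat.mod_lt _ (Nat.succ_pos _))
  have e1 := (hstep _ (hβ (i / (n + 1)))).1 _ hr
  have e2 := (hstep _ (hβ (i / (n + 1) + 1))).1 _ hr
  rw [Nat.div_add_mod] at e1
  rw [mul_add, mul_one, add_right_comm, Nat.div_add_mod] at e2
  rw [e1, e2]

/-- A period of `M⁻` is a return time of the orbit of `β`. -/
theorem return_of_periodic {α β : ℝ} (hU : (α, β) ∈ U) {k : ℕ}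
    (h : ∀ i, minus (kneading α β) (i + k) = minus (kneading α β) i) :
    (T α β)^[k] β = β := by
  obtain ⟨-, -, hβ, -, -, l, hl, hpl, hql⟩ := contraction hU
  have key := eq_of_follow (B := β) (w := minus (kneading α β)) (u := fun i => (T α β)^[i + k] β)
    (v := fun i => (T α β)^[i] β) hpl hql hl (fun i => ?_) (fun i => ?_) (fun i => ?_)
  · simpa using key
  · have := (onSide_minus hU (i + k)).eq_invBranch hU
    rwa [h, ← Function.iterate_succ_apply' (T α β), ← Nat.succ_add] at this
  · have := (onSide_minus hU i).eq_invBranch hU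
    rwa [← Function.iterate_succ_apply' (T α β)] at this
  · have h1 := iterate_mem_Icc hU (i + k)
    have h2 := iterate_mem_Icc hU i
    rw [abs_le]
    constructor <;> linarith [h1.1, h1.2, h2.1, h2.2]

theorem codedOrbit_minus_ne {α β α' β' : ℝ} (hU : (α, β) ∈ U) (hU' : (α', β') ∈ U)
    (h : Prec (kneading α' β') (kneading α β)) :
    codedOrbit α β (minus (kneading α' β')) 0 ≠ β := by
  obtain ⟨h0', h1', hβ', -⟩ := contraction hU'
  have hw : ∀ i, minus (kneading α' β') i = .L ∨ minus (kneading α' β') i = .R := fun i =>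
    (onSide_minus hU' i).imp And.left And.left
  have hprec : ∀ k, Prec (toStr fun i => minus (kneading α' β') (k + i)) (kneading α β) := by
    intro k
    rcases shift_minus_le hU' k with e | e
    · rw [funext e]
      exact minus_prec h
    · exact e.trans (minus_prec h)
  intro hx
  obtain ⟨n, hC, hi, hper⟩ := periodic_of_codedOrbit_eq hU hw hprec hx
  have hret := return_of_periodic hU' hper
  rw [Function.iterate_succ_apply'] at hret
  have hα' := extItinerary_eq_C.2 (eq_of_T_eq h0' h1' hβ' hret)
  obtain ⟨m, a, b, he, ha, hb, ho⟩ := h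
  -- K(α,β) stops at n, so it differs from M no later. At n both sequences would carry C; before n,
  -- K(α,β) agrees with M⁻, which is on the wrong side of M if M has its C there and equals M
  -- otherwise.
  have hmn : m ≤ n := by
    by_contra hc
    exact (kneading_eq_some_iff.1 hb).1 n (by omega) (kneading_eq_some_iff.1 hC).2
  have hwm : a ≠ .C → minus (kneading α' β') m = a := (minus_of_kneading_eq_some ha).1
  have hab : a ≠ b := by
    rintro rfl
    rcases ho with ⟨-, l⟩ | ⟨-, l⟩ <;> cases a <;> simp [Symbol.Lt] at l
  rcases hmn.eq_or_lt with rfl | hlt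
  · exact hab ((kneading_eq_some_iff.1 ha).2.symm.trans
      (hα'.trans (Option.some.inj (hC.symm.trans hb))))
  · have hbm : b = minus (kneading α' β') m := Option.some.inj (hb.symm.trans (hi m hlt))
    by_cases haC : a = .C
    · subst haC
      rw [(minus_of_kneading_eq_some ha).2 rfl] at hbm
      rcases ho with ⟨e, l⟩ | ⟨e, l⟩
      · rw [if_pos e] at hbm
        simp [hbm, Symbol.Lt] at l
      · rw [if_neg e] at hbm
        simp [hbm, Symbol.Lt] at l
    · exact hab ((hwm haC).symm.trans hbm.symm)

/-! ### Infinitely many symbols `R` -/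

/-- A tail of L's forces the orbit onto the fixed point 0 of the left branch. An orbit in [0, β] can
reach 0 from a nonzero point only through 1, so β = 1, and K(1/2, 1) = R L^∞ is the excluded case.
-/
theorem infinite_minus {β : ℝ} (hU : (1 / 2, β) ∈ U) (hM : kneading (1 / 2) β ≠ RLinf) :
    {i | minus (kneading (1 / 2) β) i = .R}.Infinite := by
  obtain ⟨h0, h1, hβ, -, -, l, hl, hpl, hql⟩ := contraction hU
  have hβ1 : β ≤ 1 := hU.2.1
  intro hfin
  obtain ⟨k, hk⟩ := hfin.bddAbove
  have hL : ∀ i, minus (kneading (1 / 2) β) (k + 1 + i) = .L := fun i =>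
    ((onSide_minus hU (k + 1 + i)).imp And.left And.left).resolve_right fun hR => by
      have := hk hR
      omega
  have hzero : (T (1 / 2) β)^[k + 1] β = 0 := by
    refine eq_of_follow (B := β) (w := fun _ => .L) (u := fun i => (T (1 / 2) β)^[k + 1 + i] β)
      (v := fun _ => 0) hpl hql hl (fun i => ?_) (fun i => by simp [invBranch]) (fun i => ?_)
    · have := (onSide_minus hU (k + 1 + i)).eq_invBranch hU
      rwa [hL, ← iterate_add_succ] at this
    · have h1 := iterate_mem_Icc hU (k + 1 + i)
      rw [sub_zero, abs_of_nonneg h1.1]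
      exact h1.2
  have hone : β = 1 := by
    have : ∀ n, (T (1 / 2) β)^[n] β = 0 → β = 1 := by
      intro n
      induction n with
      | zero =>
        intro h
        simp only [Function.iterate_zero, id] at h
        linarith
      | succ n ih =>
        intro h
        rw [Function.iterate_succ_apply'] at h
        rcases le_total ((T (1 / 2) β)^[n] β) (1 / 2) with hx | hx
        · have := T_left h0 hβ hx
          rw [h, mul_zero] at this
          exact ih this
        · have := T_right h0 h1 hβ hx
          rw [h, mul_zero] at this
          linarith [(iterate_mem_Icc hU n).2]
    exact this _ hzero
  subst hone
  apply hM
  have hit : ∀ n, (T (1 / 2) 1)^[n + 1] 1 = 0 := by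
    intro n
    induction n with
    | zero => norm_num [T]
    | succ n ih =>
      rw [Function.iterate_succ_apply', ih]
      norm_num [T]
  have hext : ∀ n, extItinerary (1 / 2) 1 1 n = if n = 0 then .R else .L := by
    intro n
    rcases n with _ | n
    · norm_num [extItinerary]
    · rw [extItinerary, hit]
      norm_num
  funext n
  rw [kneading_eq_some, hext, RLinf]
  · split_ifs <;> rfl
  · intro j _
    rw [hext]
    split_ifs <;> simp

theorem minus_zero {α β : ℝ} (hU : (α, β) ∈ U) : minus (kneading α β) 0 = .R := by
  refine ((onSide_minus hU 0).imp And.right And.left).resolve_left fun h => ?_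
  exact absurd hU.2.2.2 (not_lt.2 h)

end SkewTent

theorem mainTheorem2 (M : SkewTent.Str) (hM : M ∈ SkewTent.kneadingClass)
    (hM' : M ≠ SkewTent.RLinf) (α β : ℝ) (hU : (α, β) ∈ SkewTent.U)
    (hK : SkewTent.Prec M (SkewTent.kneading α β)) :
    SkewTent.minus M = SkewTent.blockWord (SkewTent.blockLength (SkewTent.minus M)) ∧
      Summable (fun k : ℕ => SkewTent.thetaTerm M α β (k + 1)) ∧
      SkewTent.Theta M α β ≠ 0 := by
  obtain ⟨β', hβ1, hβ2, rfl⟩ := hM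
  have hU' : ((1 / 2 : ℝ), β') ∈ SkewTent.U := ⟨hβ1, hβ2, by simp only; linarith, hβ1⟩
  have hinf := SkewTent.infinite_minus hU' hM'
  have h0 := SkewTent.minus_zero hU'
  obtain ⟨-, -, -, -, -, l, hl, hpl, hql⟩ := SkewTent.contraction hU
  have hsum : HasSum (fun k => SkewTent.thetaTerm (SkewTent.kneading (1 / 2) β') α β k)
      (SkewTent.codedPoint ((1 - α) / β) (α / β)
        (SkewTent.minus (SkewTent.kneading (1 / 2) β'))) :=
    SkewTent.hasSum_blocks hpl hql hl h0 hinf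
  refine ⟨SkewTent.eq_blockWord
    (fun i => (SkewTent.onSide_minus hU' i).imp And.left And.left) h0 hinf,
    (summable_nat_add_iff 1).2 hsum.summable, fun hΘ => ?_⟩
  -- The k = 0 term of the block series is 1, so the coded point of M⁻ is Θ_M + β, and Θ_M = 0 would
  -- make it β.
  refine SkewTent.codedOrbit_minus_ne hU hU' hK ?_
  have h1 := hsum.summable.tsum_eq_zero_add
  rw [hsum.tsum_eq] at h1
  have h2 : SkewTent.thetaTerm (SkewTent.kneading (1 / 2) β') α β 0 = 1 := by
    simp [SkewTent.thetaTerm, SkewTent.blockSum]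
  rw [SkewTent.Theta] at hΘ
  simp only [SkewTent.codedOrbit, zero_add]
  linarith
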